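/- All graphs are finite and simple. A proper colouring $\sigma$ of a graph $G$ is called proper conflict-free if for every non-isolated vertex $v$ some colour appears exactly once in the neighbourhood $N(v)$, i.e. there is a neighbour $u \in N(v)$ with $\sigma(w) \neq \sigma(u)$ for all $w \in N(v)\setminus\{u\}$. Let $\chi_{\mathrm{pcf}}(G)$ be the smallest integer $k$ such that $G$ has a proper conflict-free colouring with $k$ colours. Theorem. There is an absolute constant $C > 0$ such that every graph $G$ of maximum degree $\Delta \ge 2$ satisfies $$\chi_{\mathrm{pcf}}(G) \le \Delta + C \log \Delta .$$ -/

import Mathlib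

namespace SimpleGraph

/-- A neighbour `u` of `v` is a witness of `v` in the colouring `σ` if the colour of `u` appears
exactly once in the neighbourhood of `v`. -/
def IsWitness {V α : Type*} (G : SimpleGraph V) (σ : V → α) (v u : V) : Prop :=
  G.Adj v u ∧ ∀ w, G.Adj v w → σ w = σ u → w = u

/-- A colouring is proper conflict-free (pcf) if adjacent vertices receive distinct colours and
every non-isolated vertex has a witness. -/
def IsPcfColoring {V α : Type*} (G : SimpleGraph V) (σ : V → α) : Prop :=
  (∀ u v, G.Adj u v → σ u ≠ σ v) ∧
    ∀ v, (∃ u, G.Adj v u) → ∃ u, G.IsWitness σ v u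

/-- The least `k` such that `G` has a pcf `k`-colouring. For a finite graph such a `k` exists,
see `exists_pcfColoring`. -/
noncomputable def pcfChromaticNumber {V : Type*} (G : SimpleGraph V) : ℕ :=
  sInf {k : ℕ | ∃ σ : V → Fin k, G.IsPcfColoring σ}

/-- For a finite graph, the infimum defining the pcf chromatic number is over a nonempty set,
so that it is attained. -/
theorem exists_pcfColoring {V : Type*} [Finite V] (G : SimpleGraph V) :
    ∃ σ : V → Fin G.pcfChromaticNumber, G.IsPcfColoring σ := by
  have h : {k : ℕ | ∃ σ : V → Fin k, G.IsPcfColoring σ}.Nonempty := by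
    obtain ⟨n, ⟨e⟩⟩ := Finite.exists_equiv_fin V
    refine ⟨n, e, fun u v huv h => G.ne_of_adj huv (e.injective h), ?_⟩
    rintro v ⟨u, hu⟩
    exact ⟨u, hu, fun w _ hw => e.injective hw⟩
  exact Nat.sInf_mem h

end SimpleGraph

/-! Order the vertices so that those of degree above `Δ / 2` come first, and give every non-isolated
vertex of degree at most `Δ / 2` its earliest neighbour as prescribed witness, whose colour the
other neighbours must avoid. Each vertex then has at most `Δ` earlier vertices to avoid
(`exists_constraint_orientation`), so greedy colouring with `Δ + 1` colours gives properness and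
serves all low-degree vertices.

About `320 log Δ` extra colours serve the vertices of degree above `Δ / 2`. Independently, each
vertex picks each extra colour with probability `1 / (4Δ)`; it replaces its greedy colour by its
first pick, unless a vertex it must avoid picks that colour too. All avoidance constraints survive
this recolouring.

Reveal the extra colours one at a time. While at least half of `N(v)` has picked nothing, the next
colour has exactly one taker in `N(v)` with conditional probability at least `1 / 32`, whatever the
history. Hence `v` fails with probability at most `2 Δ⁻¹⁰` (`card_not_hasUniqueTaker_le`). Failure
depends only on the ball of radius 3, so the local lemma avoids all failures when `Δ` is large;
bounded `Δ` goes into `C`. -/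

section Counting

/-! ### Product measure by counting, and the local lemma. -/

open Finset

/-- The number of points of a box is the product of the sizes of its sides. -/
theorem card_filter_forall_mem {V T : Type*} [Fintype V] [DecidableEq V] [Fintype T]
    (Q : V → Finset T) [DecidablePred fun x : V → T => ∀ y, x y ∈ Q y] :
    #{x : V → T | ∀ y, x y ∈ Q y} = ∏ y, #(Q y) := by
  rw [← Fintype.card_piFinset]
  congr 1
  ext x
  simp [Fintype.mem_piFinset]

/-- Events depending on disjoint sets of coordinates are independent. -/
theorem card_inter_mul_card_of_dependsOn {V T : Type*} [Fintype V] [DecidableEq V] [Fintype T]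
    [DecidableEq T] (S : Finset V) (A B : Finset (V → T))
    (hA : ∀ x y : V → T, (∀ u ∉ S, x u = y u) → x ∈ A → y ∈ A)
    (hB : ∀ x y : V → T, (∀ u ∈ S, x u = y u) → x ∈ B → y ∈ B) :
    #(A ∩ B) * Fintype.card (V → T) = #A * #B := by
  rw [← Finset.card_univ, ← card_product, ← card_product]
  -- Exchanging the `S`-coordinates of two points is an involution on pairs. It carries `(A ∩ B) ×
  -- Ω` onto `A × B`, as `A` ignores `S` and `B` sees only `S`.
  let mix : (V → T) → (V → T) → V → T := fun x y u => if u ∈ S then y u else x u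
  refine card_nbij' (fun z => (mix z.1 z.2, mix z.2 z.1)) (fun z => (mix z.1 z.2, mix z.2 z.1))
    ?_ ?_ ?_ ?_
  · rintro ⟨x, y⟩ h
    simp only [coe_product, Set.mem_prod, mem_coe, mem_inter, mem_univ, and_true] at h ⊢
    refine ⟨hA x _ (fun u hu => by simp [mix, hu]) h.1, hB x _ (fun u hu => by simp [mix, hu]) h.2⟩
  · rintro ⟨x, y⟩ h
    simp only [coe_product, Set.mem_prod, mem_coe, mem_inter, mem_univ, and_true] at h ⊢
    exact ⟨hA x _ (fun u hu => by simp [mix, hu]) h.1, hB y _ (fun u hu => by simp [mix, hu]) h.2⟩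
  · rintro ⟨x, y⟩ -
    simp only [Prod.mk.injEq]
    constructor <;> funext u <;> by_cases hu : u ∈ S <;> simp [mix, hu]
  · rintro ⟨x, y⟩ -
    simp only [Prod.mk.injEq]
    constructor <;> funext u <;> by_cases hu : u ∈ S <;> simp [mix, hu]

/-- The symmetric Lovász local lemma on a finite product space with the uniform measure. -/
theorem lovasz_local_lemma {V T ι : Type*} [Fintype V] [DecidableEq V] [Fintype T]
    [DecidableEq T] [Nonempty T] [Fintype ι] [DecidableEq ι]
    (B : ι → Finset (V → T)) (S : ι → Finset V)
    (hdep : ∀ i, ∀ x y : V → T, (∀ u ∈ S i, x u = y u) → x ∈ B i → y ∈ B i)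
    (Γ : ι → Finset ι) (hΓ : ∀ i j, j ∉ Γ i → Disjoint (S i) (S j))
    (p D : ℝ) (hp0 : 0 ≤ p) (hD1 : 1 ≤ D) (hD : ∀ i, (#(Γ i) : ℝ) ≤ D)
    (hp : ∀ i, (#(B i) : ℝ) ≤ p * Fintype.card (V → T)) (hpD : 4 * p * D ≤ 1) :
    ∃ x : V → T, ∀ i, x ∉ B i := by
  classical
  let A : Finset ι → Finset (V → T) := fun s => {x | ∀ j ∈ s, x ∉ B j}
  have memA : ∀ s x, x ∈ A s ↔ ∀ j ∈ s, x ∉ B j := fun s x => by simp [A]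
  have hΩ : (0 : ℝ) < Fintype.card (V → T) := by exact_mod_cast Fintype.card_pos
  -- The conditional probability of `B i` given `A s` is at most `2p`; the product form also covers
  -- empty `A s`.
  have key : ∀ n : ℕ, ∀ s : Finset ι, #s = n → ∀ i,
      (#(A s ∩ B i) : ℝ) ≤ 2 * p * #(A s) := by
    intro n
    induction n using Nat.strong_induction_on with
    | _ n ih =>
      intro s hs i
      set s₁ := s ∩ Γ i with hs₁
      set s₂ := s \ Γ i with hs₂
      have hsub : A s ⊆ A s₂ := fun x hx => by
        rw [memA] at hx ⊢
        exact fun j hj => hx j (mem_sdiff.1 hj).1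
      have hind : (#(A s₂ ∩ B i) : ℝ) ≤ p * #(A s₂) := by
        have h := card_inter_mul_card_of_dependsOn (S i) (A s₂) (B i)
          (fun x y hxy hx => by
            rw [memA] at hx ⊢
            intro j hj hy
            have hdis := hΓ i j (mem_sdiff.1 hj).2
            exact hx j hj (hdep j y x (fun u hu =>
              (hxy u fun h => (disjoint_left.1 hdis h hu)).symm) hy)) (hdep i)
        have h' : (#(A s₂ ∩ B i) : ℝ) * Fintype.card (V → T) = #(A s₂) * #(B i) := by
          exact_mod_cast h
        have h2 : (#(A s₂) : ℝ) * #(B i) ≤ #(A s₂) * (p * Fintype.card (V → T)) :=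
          mul_le_mul_of_nonneg_left (hp i) (by positivity)
        rw [← h'] at h2
        refine le_of_mul_le_mul_right (h2.trans (le_of_eq (by ring))) hΩ
      have hmono : (#(A s ∩ B i) : ℝ) ≤ #(A s₂ ∩ B i) := by
        exact_mod_cast card_le_card (inter_subset_inter_right hsub)
      by_cases hemp : s₁ = ∅
      · have : s₂ = s := by
          rw [hs₂, Finset.sdiff_eq_self_iff_disjoint, disjoint_comm, disjoint_iff_inter_eq_empty,
            inter_comm]
          exact hemp
        rw [this] at hind
        have : (0 : ℝ) ≤ p * #(A s) := by positivity
        linarith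
      · have hlt : #s₂ < n := by
          rw [← hs]
          refine card_lt_card (Finset.ssubset_iff_subset_ne.2 ⟨sdiff_subset, fun h => hemp ?_⟩)
          rw [hs₁, ← disjoint_iff_inter_eq_empty]
          exact (Finset.sdiff_eq_self_iff_disjoint.1 h)
        -- By induction, each of the at most `D` events in `s₁` removes at most a fraction `2p` of
        -- `A s₂`. As `2pD ≤ 1/2`, at least half of it remains in `A s`.
        have hcov : A s₂ ⊆ A s ∪ s₁.biUnion fun j => A s₂ ∩ B j := by
          intro x hx
          by_cases hxs : x ∈ A s
          · exact mem_union_left _ hxs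
          · rw [memA] at hxs
            push Not at hxs
            obtain ⟨j, hj, hxj⟩ := hxs
            have : j ∈ s₁ := by
              by_contra hj1
              have hj2 : j ∈ s₂ := by
                rw [hs₂, mem_sdiff]
                exact ⟨hj, fun h => hj1 (mem_inter.2 ⟨hj, h⟩)⟩
              exact (memA _ _).1 hx j hj2 hxj
            exact mem_union_right _ (mem_biUnion.2 ⟨j, this, mem_inter.2 ⟨hx, hxj⟩⟩)
        have h1 : (#(A s₂) : ℝ) ≤ #(A s) + ∑ j ∈ s₁, (#(A s₂ ∩ B j) : ℝ) := by
          have := (card_le_card hcov).trans (card_union_le _ _)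
          have h2 := this.trans (Nat.add_le_add_left card_biUnion_le _)
          exact_mod_cast h2
        have h2 : ∑ j ∈ s₁, (#(A s₂ ∩ B j) : ℝ) ≤ #s₁ * (2 * p * #(A s₂)) := by
          rw [← nsmul_eq_mul]
          exact sum_le_card_nsmul _ _ _ fun j _ => ih _ hlt s₂ rfl j
        have h3 : (#s₁ : ℝ) ≤ D :=
          le_trans (by exact_mod_cast card_le_card inter_subset_right) (hD i)
        have h4 : (#s₁ : ℝ) * (2 * p * #(A s₂)) ≤ D * (2 * p * #(A s₂)) :=
          mul_le_mul_of_nonneg_right h3 (by positivity)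
        have h5 : D * (2 * p * #(A s₂)) ≤ 1 / 2 * #(A s₂) := by
          have : D * (2 * p) ≤ 1 / 2 := by linarith
          calc D * (2 * p * #(A s₂)) = D * (2 * p) * #(A s₂) := by ring
            _ ≤ _ := mul_le_mul_of_nonneg_right this (by positivity)
        have h6 : (#(A s₂) : ℝ) ≤ 2 * #(A s) := by linarith
        calc (#(A s ∩ B i) : ℝ) ≤ p * #(A s₂) := hmono.trans hind
          _ ≤ p * (2 * #(A s)) := mul_le_mul_of_nonneg_left h6 hp0
          _ = _ := by ring
  have hp4 : p ≤ 1 / 4 := by nlinarith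
  have hpos : ∀ s : Finset ι, (0 : ℝ) < #(A s) := by
    intro s
    induction s using Finset.induction_on with
    | empty =>
      have : A ∅ = univ := by ext; simp [memA]
      rw [this, Finset.card_univ]
      exact hΩ
    | insert i s _ ih =>
      have hcov : A s ⊆ A (insert i s) ∪ (A s ∩ B i) := by
        intro x hx
        by_cases hi : x ∈ B i
        · exact mem_union_right _ (mem_inter.2 ⟨hx, hi⟩)
        · refine mem_union_left _ ((memA _ _).2 fun j hj => ?_)
          rcases mem_insert.1 hj with rfl | hj
          · exact hi
          · exact (memA _ _).1 hx j hj
      have h1 : (#(A s) : ℝ) ≤ #(A (insert i s)) + #(A s ∩ B i) := by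
        exact_mod_cast (card_le_card hcov).trans (card_union_le _ _)
      have h2 := key _ s rfl i
      nlinarith
  have h := hpos univ
  rw [Nat.cast_pos, card_pos] at h
  obtain ⟨x, hx⟩ := h
  exact ⟨x, fun i => (memA _ _).1 hx i (mem_univ i)⟩

/-- If every round of a process fails for at most `q` of its outcomes, whatever the history, then
at most `q ^ K` sequences of outcomes fail in all rounds. -/
theorem card_forall_fail_le {X : Type*} [Fintype X] [DecidableEq X] (q : ℝ) (hq : 0 ≤ q)
    (F : ∀ c : ℕ, (Fin c → X) → X → Prop) [∀ c h x, Decidable (F c h x)]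
    (hF : ∀ c h, (#{x | F c h x} : ℝ) ≤ q) (K : ℕ) :
    (#{η : Fin K → X | ∀ c : Fin K, F c (fun i => η (i.castLE c.2.le)) (η c)} : ℝ) ≤ q ^ K := by
  induction K with
  | zero => simp
  | succ K ih =>
    have hle : #{η : Fin (K + 1) → X | ∀ c : Fin (K + 1), F c (fun i => η (i.castLE c.2.le)) (η c)}
        ≤ #(({η : Fin K → X | ∀ c : Fin K, F c (fun i => η (i.castLE c.2.le)) (η c)} : Finset _).sigma
          fun h => ({x | F K h x} : Finset X)) := by
      refine card_le_card_of_injOn (fun η => ⟨Fin.init η, η (Fin.last K)⟩) ?_ ?_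
      · intro η h
        simp only [coe_filter, mem_univ, true_and, Set.mem_ofPred_eq, coe_sigma,
          Set.mem_sigma_iff] at h ⊢
        exact ⟨fun c => h c.castSucc, h (Fin.last K)⟩
      · intro η _ η' _ h
        simp only [Sigma.mk.injEq, heq_eq_eq] at h
        rw [← Fin.snoc_init_self η, ← Fin.snoc_init_self η', h.1, h.2]
    rw [card_sigma] at hle
    have h1 : ((∑ h ∈ ({η : Fin K → X | ∀ c : Fin K, F c (fun i => η (i.castLE c.2.le)) (η c)} :
        Finset _), #{x | F K h x} : ℕ) : ℝ) ≤ q ^ K * q := by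
      push_cast
      refine (sum_le_card_nsmul _ _ q fun h _ => hF K h).trans ?_
      rw [nsmul_eq_mul]
      exact mul_le_mul_of_nonneg_right ih hq
    rw [pow_succ]
    exact le_trans (by exact_mod_cast hle) h1

end Counting

/-! ### Random picks and uniquely taken colours. -/

section RandomPicks

open Finset

/-- The number of points at which `W` contains exactly one vertex of value `z`, none of whose
`O`-neighbours has value `z`. -/
theorem le_card_exists_unique_pick {V T : Type*} [Fintype V] [DecidableEq V] [Fintype T]
    [DecidableEq T] (z : T) (W : Finset V) (O : V → Finset V) (R : ℝ)
    (hO : ∀ u ∈ W, u ∉ O u) (hR : ∀ u ∈ W, (#W : ℝ) + #(O u) ≤ R) :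
    #W / Fintype.card T * (1 - R / Fintype.card T) * Fintype.card (V → T) ≤
      (#{x : V → T | ∃ u ∈ W, x u = z ∧ (∀ w ∈ W, w ≠ u → x w ≠ z) ∧ ∀ y ∈ O u, x y ≠ z} : ℝ) := by
  set M := (Fintype.card T : ℝ) with hM
  have hM1 : 1 ≤ M := by
    have : 0 < Fintype.card T := Fintype.card_pos_iff.2 ⟨z⟩
    rw [hM]
    exact_mod_cast this
  let A : V → Finset (V → T) := fun u =>
    {x | x u = z ∧ (∀ w ∈ W, w ≠ u → x w ≠ z) ∧ ∀ y ∈ O u, x y ≠ z}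
  have hdis : (W : Set V).PairwiseDisjoint A := by
    intro u hu v hv huv
    refine disjoint_left.2 fun x hx hy => ?_
    simp only [A, mem_filter, mem_univ, true_and] at hx hy
    exact hx.2.1 v hv huv.symm hy.1
  have hsub : W.biUnion A ⊆
      ({x : V → T | ∃ u ∈ W, x u = z ∧ (∀ w ∈ W, w ≠ u → x w ≠ z) ∧ ∀ y ∈ O u, x y ≠ z} :
        Finset (V → T)) := by
    intro x hx
    obtain ⟨u, hu, hx⟩ := mem_biUnion.1 hx
    simp only [A, mem_filter, mem_univ, true_and] at hx ⊢
    exact ⟨u, hu, hx⟩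
  have hA : ∀ u ∈ W, 1 / M * (1 - R / M) * Fintype.card (V → T) ≤ (#(A u) : ℝ) := by
    intro u hu
    set Z := (W ∪ O u).erase u with hZ
    let Q : V → Finset T := fun y => if y = u then {z} else if y ∈ Z then univ.erase z else univ
    -- The event is a box, so its probability is an exact product; Bernoulli's inequality then
    -- bounds it below.
    have hAQ : A u = ({x : V → T | ∀ y, x y ∈ Q y} : Finset (V → T)) := by
      ext x
      simp only [A, Q, mem_filter, mem_univ, true_and]
      constructor
      · rintro ⟨h1, h2, h3⟩ y
        by_cases hy : y = u
        · simp [hy, h1]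
        by_cases hyZ : y ∈ Z
        · simp only [hy, hyZ, if_true, if_false, mem_erase, mem_univ, and_true]
          rcases mem_union.1 (mem_erase.1 hyZ).2 with h | h
          exacts [h2 y h hy, h3 y h]
        · simp [hy, hyZ]
      · intro h
        refine ⟨by simpa using h u, fun w hw hwu => ?_, fun w hw => ?_⟩
        · have hwZ : w ∈ Z := by simp [hZ, hw, hwu]
          simpa [hwu, hwZ] using h w
        · have hwu : w ≠ u := fun h => hO u hu (h ▸ hw)
          have hwZ : w ∈ Z := by simp [hZ, hw, hwu]
          simpa [hwu, hwZ] using h w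
    have hQ : ∀ y, (#(Q y) : ℝ) =
        ((if y = u then 1 / M else 1) * (if y ∈ Z then 1 - 1 / M else 1)) * M := by
      intro y
      by_cases hy : y = u
      · have : y ∉ Z := by simp [hZ, hy]
        simp only [Q, hy] at this ⊢
        simp only [if_true, this, if_false, card_singleton]
        field_simp
        simp
      · by_cases hyZ : y ∈ Z
        · simp only [Q, hy, hyZ, if_true, if_false]
          rw [card_erase_of_mem (mem_univ z), Finset.card_univ,
            Nat.cast_sub (Fintype.card_pos_iff.2 ⟨z⟩), ← hM]
          field_simp
          simp
        · simp only [Q, hy, hyZ, if_false, Finset.card_univ, ← hM]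
          ring
    have hcard : (#(A u) : ℝ) = 1 / M * (1 - 1 / M) ^ #Z * Fintype.card (V → T) := by
      rw [hAQ, card_filter_forall_mem]
      push_cast
      rw [prod_congr rfl fun y _ => hQ y, prod_mul_distrib, prod_mul_distrib, prod_ite_eq',
        prod_ite_mem]
      simp [hM]
    have hZR : (#Z : ℝ) ≤ R := by
      refine le_trans ?_ (hR u hu)
      exact_mod_cast (card_le_card (erase_subset _ _)).trans (card_union_le _ _)
    have hbern : 1 - R / M ≤ (1 - 1 / M) ^ #Z := by
      have hM' : 1 / M ≤ 1 := by rw [div_le_one (by linarith)]; exact hM1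
      have := one_add_mul_le_pow (a := -(1 / M)) (by linarith) #Z
      have h2 : (#Z : ℝ) / M ≤ R / M := by gcongr
      calc 1 - R / M ≤ 1 - #Z / M := by linarith
        _ = 1 + #Z * -(1 / M) := by ring
        _ ≤ (1 + -(1 / M)) ^ #Z := this
        _ = _ := by ring
    rw [hcard]
    gcongr
  calc #W / M * (1 - R / M) * Fintype.card (V → T)
      = #W • (1 / M * (1 - R / M) * Fintype.card (V → T) : ℝ) := by rw [nsmul_eq_mul]; ring
    _ ≤ ∑ u ∈ W, (#(A u) : ℝ) := card_nsmul_le_sum _ _ _ hA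
    _ = (#(W.biUnion A) : ℝ) := by rw [card_biUnion hdis]; push_cast; rfl
    _ ≤ _ := by exact_mod_cast card_le_card hsub

/-- The number of points at which at least half of the coordinates in `N` have a value in `P`. -/
theorem card_half_mem_le {V T : Type*} [Fintype V] [DecidableEq V] [Fintype T]
    [DecidableEq T] (P : Finset T) (N : Finset V) (y : ℝ) (hy0 : 0 ≤ y) (hy1 : y ≤ 1)
    (hP : (#P : ℝ) ≤ y ^ 2 * Fintype.card T) :
    (#{x : V → T | #N ≤ 2 * #{u ∈ N | x u ∈ P}} : ℝ) ≤ (2 * y) ^ #N * Fintype.card (V → T) := by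
  set J : Finset (Finset V) := {A ∈ N.powerset | #N ≤ 2 * #A} with hJ
  -- Union bound over the at most `2 ^ #N` possible large sets `A` of coordinates with value in `P`.
  -- Each has probability at most `(y ^ 2) ^ #A ≤ y ^ #N`, because `2 * #A ≥ #N`.
  have hsub : ({x : V → T | #N ≤ 2 * #{u ∈ N | x u ∈ P}} : Finset (V → T)) ⊆
      J.biUnion fun A => {x : V → T | ∀ u, x u ∈ if u ∈ A then P else univ} := by
    intro x hx
    simp only [mem_filter, mem_univ, true_and] at hx
    refine mem_biUnion.2 ⟨{u ∈ N | x u ∈ P}, ?_, ?_⟩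
    · simp [hJ, hx]
    · simp only [mem_filter, mem_univ, true_and]
      intro u
      split_ifs with h
      exacts [h.2, mem_univ _]
  have hA : ∀ A ∈ J, (#{x : V → T | ∀ u, x u ∈ if u ∈ A then P else univ} : ℝ) ≤
      y ^ #N * Fintype.card (V → T) := by
    intro A hA
    rw [hJ, mem_filter] at hA
    rw [card_filter_forall_mem]
    push_cast
    calc ∏ u, (#(if u ∈ A then P else univ) : ℝ)
        ≤ ∏ u : V, ((if u ∈ A then y ^ 2 else 1) * Fintype.card T : ℝ) := by
          refine prod_le_prod (fun _ _ => by positivity) fun u _ => ?_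
          split_ifs
          exacts [hP, by simp]
      _ = y ^ (2 * #A) * Fintype.card (V → T) := by
          rw [prod_mul_distrib, prod_ite_mem]
          simp [pow_mul]
      _ ≤ _ := mul_le_mul_of_nonneg_right (pow_le_pow_of_le_one hy0 hy1 hA.2) (by positivity)
  have hJc : (#J : ℝ) ≤ 2 ^ #N := by
    have := (card_le_card (filter_subset (fun A => #N ≤ 2 * #A) N.powerset)).trans_eq
      (card_powerset N)
    exact_mod_cast this
  calc (#{x : V → T | #N ≤ 2 * #{u ∈ N | x u ∈ P}} : ℝ)
      ≤ ∑ A ∈ J, (#{x : V → T | ∀ u, x u ∈ if u ∈ A then P else univ} : ℝ) := by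
        exact_mod_cast (card_le_card hsub).trans card_biUnion_le
    _ ≤ #J • (y ^ #N * Fintype.card (V → T) : ℝ) := sum_le_card_nsmul _ _ _ hA
    _ = #J * (y ^ #N * Fintype.card (V → T) : ℝ) := nsmul_eq_mul _ _
    _ ≤ 2 ^ #N * (y ^ #N * Fintype.card (V → T) : ℝ) :=
        mul_le_mul_of_nonneg_right hJc (by positivity)
    _ = _ := by rw [mul_pow]; ring

/-- Vertex `u` takes colour `c` if `c` is the first colour it picks (that is, of value `z`),
and no vertex of `O u` picks `c`. -/
def Takes {V T : Type*} {K : ℕ} (z : T) (O : V → Finset V) (x : V → Fin K → T) (u : V)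
    (c : Fin K) : Prop :=
  x u c = z ∧ (∀ c' < c, x u c' ≠ z) ∧ ∀ y ∈ O u, x y c ≠ z

theorem Takes.unique {V T : Type*} {K : ℕ} {z : T} {O : V → Finset V} {x : V → Fin K → T} {u : V}
    {c c' : Fin K} (h : Takes z O x u c) (h' : Takes z O x u c') : c = c' := by
  rcases lt_trichotomy c c' with hlt | heq | hlt
  · exact absurd h.1 (h'.2.1 c hlt)
  · exact heq
  · exact absurd h'.1 (h.2.1 c' hlt)

/-- Some colour is taken by exactly one vertex of `N`. -/
def HasUniqueTaker {V T : Type*} {K : ℕ} (z : T) (O : V → Finset V) (N : Finset V)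
    (x : V → Fin K → T) : Prop :=
  ∃ c, ∃ u ∈ N, Takes z O x u c ∧ ∀ w ∈ N, Takes z O x w c → w = u

theorem card_exists_eq_le {T : Type*} [Fintype T] [DecidableEq T] (z : T) (K : ℕ) :
    (#{f : Fin K → T | ∃ c, f c = z} : ℝ) ≤
      K / Fintype.card T * Fintype.card (Fin K → T) := by
  have hM : (0 : ℝ) < Fintype.card T := by exact_mod_cast Fintype.card_pos_iff.2 ⟨z⟩
  have hc : ∀ c : Fin K, (#{f : Fin K → T | f c = z} : ℝ) =
      1 / Fintype.card T * Fintype.card (Fin K → T) := by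
    intro c
    have : ({f : Fin K → T | f c = z} : Finset _) =
        ({f : Fin K → T | ∀ i, f i ∈ if i = c then {z} else univ} : Finset _) := by
      ext f
      simp only [mem_filter, mem_univ, true_and]
      constructor
      · intro h i
        split_ifs with hi
        · simp [hi, h]
        · simp
      · intro h
        simpa using h c
    rw [this, card_filter_forall_mem]
    push_cast
    have h2 : ∀ i : Fin K, (#(if i = c then {z} else univ : Finset T) : ℝ) =
        (if i = c then 1 / Fintype.card T else 1 : ℝ) * Fintype.card T := by
      intro i
      split_ifs
      · field_simp; simp
      · simp
    rw [prod_congr rfl fun i _ => h2 i, prod_mul_distrib, prod_ite_eq']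
    simp
  have hsub : ({f : Fin K → T | ∃ c, f c = z} : Finset _) ⊆
      univ.biUnion fun c : Fin K => ({f : Fin K → T | f c = z} : Finset _) := by
    intro f hf
    simpa using hf
  calc (#{f : Fin K → T | ∃ c, f c = z} : ℝ)
      ≤ ∑ c : Fin K, (#{f : Fin K → T | f c = z} : ℝ) := by
        exact_mod_cast (card_le_card hsub).trans card_biUnion_le
    _ = _ := by
        rw [sum_congr rfl fun c _ => hc c, sum_const]
        simp
        ring

open Classical in
/-- It is unlikely that no colour is taken by exactly one vertex of `N`. -/
theorem card_not_hasUniqueTaker_le {V T : Type*} [Fintype V] [Fintype T]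
    (z : T) (K : ℕ) (O : V → Finset V) (N : Finset V) (R ρ y : ℝ)
    (hO : ∀ u ∈ N, u ∉ O u) (hR : ∀ u ∈ N, (#N : ℝ) + #(O u) ≤ R)
    (hRM : R ≤ Fintype.card T) (hρ1 : ρ ≤ 1)
    (hρ : ρ ≤ #N / 2 / Fintype.card T * (1 - R / Fintype.card T))
    (hy0 : 0 ≤ y) (hy1 : y ≤ 1) (hy : K / Fintype.card T ≤ y ^ 2) :
    (#{x : V → Fin K → T | ¬ HasUniqueTaker z O N x} : ℝ) ≤
      ((1 - ρ) ^ K + (2 * y) ^ #N) * Fintype.card (V → Fin K → T) := by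
  set P : Finset (Fin K → T) := {f | ∃ c, f c = z} with hPdef
  have hM : (0 : ℝ) < Fintype.card T := by exact_mod_cast Fintype.card_pos_iff.2 ⟨z⟩
  -- `S` holds the vertices of `N` without an earlier pick; only these can take colour `c`.
  -- Requiring `#N ≤ 2 * #(S c h)` inside `F` makes the bound `1 - ρ` uniform in the history; the
  -- excluded histories are counted by `hmany`.
  let S : ∀ c : ℕ, (Fin c → V → T) → Finset V := fun c h => {u ∈ N | ∀ i, h i u ≠ z}
  let F : ∀ c : ℕ, (Fin c → V → T) → (V → T) → Prop := fun c h x =>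
    #N ≤ 2 * #(S c h) ∧ ¬ ∃ u ∈ S c h, x u = z ∧ (∀ w ∈ S c h, w ≠ u → x w ≠ z) ∧
      ∀ y ∈ O u, x y ≠ z
  have hF : ∀ c h, (#{x | F c h x} : ℝ) ≤ (1 - ρ) * Fintype.card (V → T) := by
    intro c h
    by_cases hN : #N ≤ 2 * #(S c h)
    · have hS : ∀ u ∈ S c h, u ∈ N := fun u hu => (mem_filter.1 hu).1
      have hle := le_card_exists_unique_pick z (S c h) O R (fun u hu => hO u (hS u hu))
        (fun u hu => by
          refine le_trans ?_ (hR u (hS u hu))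
          have : (#(S c h) : ℝ) ≤ #N := by exact_mod_cast card_le_card hS
          linarith)
      have hN' : (#N : ℝ) / 2 ≤ #(S c h) := by
        have : (#N : ℝ) ≤ 2 * #(S c h) := by exact_mod_cast hN
        linarith
      have hρ' : ρ ≤ #(S c h) / Fintype.card T * (1 - R / Fintype.card T) := by
        refine hρ.trans (mul_le_mul_of_nonneg_right (by gcongr) ?_)
        rw [sub_nonneg, div_le_one hM]
        exact hRM
      have hle2 := (mul_le_mul_of_nonneg_right hρ'
        (Nat.cast_nonneg (Fintype.card (V → T)))).trans hle
      have hadd := card_filter_add_card_filter_not (s := (univ : Finset (V → T)))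
        (fun x => ∃ u ∈ S c h, x u = z ∧ (∀ w ∈ S c h, w ≠ u → x w ≠ z) ∧ ∀ y ∈ O u, x y ≠ z)
      rw [Finset.card_univ] at hadd
      have hadd' : ((#{x : V → T | ∃ u ∈ S c h, x u = z ∧ (∀ w ∈ S c h, w ≠ u → x w ≠ z) ∧
          ∀ y ∈ O u, x y ≠ z} : ℝ)) + (#{x : V → T | ¬ ∃ u ∈ S c h, x u = z ∧
            (∀ w ∈ S c h, w ≠ u → x w ≠ z) ∧ ∀ y ∈ O u, x y ≠ z} : ℝ) =
          Fintype.card (V → T) := by exact_mod_cast hadd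
      have hFeq : ({x | F c h x} : Finset (V → T)) = ({x : V → T | ¬ ∃ u ∈ S c h, x u = z ∧
            (∀ w ∈ S c h, w ≠ u → x w ≠ z) ∧ ∀ y ∈ O u, x y ≠ z} : Finset (V → T)) := by
        ext x
        simp only [F, mem_filter, mem_univ, true_and, hN]
      rw [hFeq]
      linarith
    · have : ({x | F c h x} : Finset (V → T)) = ∅ := by
        ext x
        simp [F, hN]
      rw [this, card_empty, Nat.cast_zero]
      exact mul_nonneg (by linarith) (by positivity)
  have hrounds := card_forall_fail_le _ (mul_nonneg (by linarith) (by positivity)) F hF K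
  have hmany := card_half_mem_le P N y hy0 hy1
    ((card_exists_eq_le z K).trans (mul_le_mul_of_nonneg_right hy (by positivity)))
  have hΩ : (Fintype.card (V → Fin K → T) : ℝ) = (Fintype.card (V → T) : ℝ) ^ K := by
    have : Fintype.card (V → Fin K → T) = Fintype.card (Fin K → V → T) :=
      Fintype.card_congr (Equiv.piComm _)
    rw [this]
    simp
  have hcov : #{x : V → Fin K → T | ¬ HasUniqueTaker z O N x} ≤
      #{η : Fin K → V → T | ∀ c : Fin K, F c (fun i => η (i.castLE c.2.le)) (η c)} +
      #{x : V → Fin K → T | #N ≤ 2 * #{u ∈ N | x u ∈ P}} := by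
    have hsub : ({x : V → Fin K → T | ¬ HasUniqueTaker z O N x} : Finset _) ⊆
        ({x : V → Fin K → T | ∀ c : Fin K, F c (fun i u => x u (i.castLE c.2.le))
          (fun u => x u c)} : Finset _) ∪
        ({x : V → Fin K → T | #N ≤ 2 * #{u ∈ N | x u ∈ P}} : Finset _) := by
      intro x hx
      simp only [mem_union, mem_filter, mem_univ, true_and] at hx ⊢
      by_contra hcon
      push Not at hcon
      obtain ⟨⟨c, hc⟩, hsm⟩ := hcon
      have hbig : #N ≤ 2 * #(S c fun i u => x u (i.castLE c.2.le)) := by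
        have h1 := card_filter_add_card_filter_not (s := N) (fun u => x u ∈ P)
        have h2 : #{u ∈ N | ¬ x u ∈ P} ≤ #(S c fun i u => x u (i.castLE c.2.le)) := by
          refine card_le_card fun u hu => ?_
          simp only [hPdef, mem_filter, mem_univ, true_and, not_exists, S] at hu ⊢
          exact ⟨hu.1, fun i => hu.2 _⟩
        omega
      refine hc ⟨hbig, fun ⟨u, hu, h1, h2, h3⟩ => hx ?_⟩
      have hS : ∀ w, w ∈ S c (fun i u => x u (i.castLE c.2.le)) ↔
          w ∈ N ∧ ∀ c' < c, x w c' ≠ z := by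
        intro w
        simp only [S, mem_filter]
        refine and_congr_right fun _ => ⟨fun h c' hc' => h ⟨c', hc'⟩, fun h i => h _ ?_⟩
        exact Fin.lt_def.2 i.2
      rw [hS] at hu
      refine ⟨c, u, hu.1, ⟨h1, hu.2, h3⟩, fun w hw hwt => ?_⟩
      by_contra hwu
      exact h2 w ((hS w).2 ⟨hw, hwt.2.1⟩) hwu hwt.1
    refine (card_le_card hsub).trans ((card_union_le _ _).trans (Nat.add_le_add_right ?_ _))
    refine card_le_card_of_injOn (fun x c u => x u c) ?_ ?_
    · intro x hx
      simpa using hx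
    · intro x _ x' _ h
      funext u c
      exact congrFun (congrFun h c) u
  calc (#{x : V → Fin K → T | ¬ HasUniqueTaker z O N x} : ℝ)
      ≤ #{η : Fin K → V → T | ∀ c : Fin K, F c (fun i => η (i.castLE c.2.le)) (η c)} +
        #{x : V → Fin K → T | #N ≤ 2 * #{u ∈ N | x u ∈ P}} := by exact_mod_cast hcov
    _ ≤ ((1 - ρ) * Fintype.card (V → T)) ^ K + (2 * y) ^ #N * Fintype.card (V → Fin K → T) :=
        add_le_add hrounds hmany
    _ = _ := by rw [mul_pow, ← hΩ]; ring

end RandomPicks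

/-! ### Avoidance constraints and greedy colouring. -/

namespace SimpleGraph

open Finset

section Structure

variable {V : Type*} [Fintype V] (G : SimpleGraph V) [DecidableRel G.Adj]

/-- An acyclic orientation of the constraints "adjacent vertices differ" and "some neighbour of
each vertex `v` with `2 * G.degree v ≤ P` differs from all other neighbours of `v`", in which each
vertex has at most `P` out-neighbours. -/
theorem exists_constraint_orientation (P : ℕ) (hP : ∀ u, G.degree u ≤ P) :
    ∃ (O : V → Finset V) (r : V → ℕ), (∀ u, ∀ x ∈ O u, r x < r u) ∧ (∀ u, #(O u) ≤ P) ∧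
      (∀ u, ∀ x ∈ O u, G.Adj u x ∨ ∃ v, G.Adj u v ∧ G.Adj v x) ∧
      (∀ u x, G.Adj u x → x ∈ O u ∨ u ∈ O x) ∧
      ∀ v, 2 * G.degree v ≤ P → (∃ u, G.Adj v u) →
        ∃ w, G.Adj v w ∧ ∀ u, G.Adj v u → u ≠ w → w ∈ O u := by
  classical
  let e := Fintype.equivFin V
  -- The shift by `Fintype.card V` puts all low-degree vertices after all others.
  let r : V → ℕ := fun u => (e u : ℕ) + if 2 * G.degree u ≤ P then Fintype.card V else 0
  have hr : ∀ u x, r u = r x → u = x := by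
    intro u x h
    have hu := (e u).2
    have hx := (e x).2
    refine e.injective (Fin.ext ?_)
    simp only [r] at h
    split_ifs at h <;> omega
  have hHL : ∀ u x, r x < r u → 2 * G.degree x ≤ P → 2 * G.degree u ≤ P := by
    intro u x h hx
    by_contra hu
    have := (e u).2
    simp only [r, hx, hu, if_true, if_false] at h
    omega
  have hw : ∀ v, ∃ w, (∃ u, G.Adj v u) → G.Adj v w ∧ ∀ u, G.Adj v u → r w ≤ r u := by
    intro v
    by_cases h : ∃ u, G.Adj v u
    · obtain ⟨u, hu⟩ := h
      obtain ⟨w, hw, hmin⟩ := exists_min_image (G.neighborFinset v) r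
        ⟨u, (G.mem_neighborFinset v u).2 hu⟩
      refine ⟨w, fun _ => ⟨(G.mem_neighborFinset v w).1 hw, fun u hu => ?_⟩⟩
      exact hmin u ((G.mem_neighborFinset v u).2 hu)
    · exact ⟨v, fun h' => absurd h' h⟩
  choose w hw using hw
  let O : V → Finset V := fun u => {x ∈ G.neighborFinset u | r x < r u} ∪
    (({v ∈ G.neighborFinset u | 2 * G.degree v ≤ P}.image w).erase u)
  have hO : ∀ u x, x ∈ O u ↔ (G.Adj u x ∧ r x < r u) ∨
      (x ≠ u ∧ ∃ v, (G.Adj u v ∧ 2 * G.degree v ≤ P) ∧ w v = x) := by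
    intro u x
    simp [O]
  refine ⟨O, r, ?_, ?_, ?_, ?_, ?_⟩
  · intro u x hx
    rcases (hO u x).1 hx with h | ⟨hne, v, ⟨huv, -⟩, rfl⟩
    · exact h.2
    · exact lt_of_le_of_ne ((hw v ⟨u, huv.symm⟩).2 u huv.symm) fun h => hne (hr _ _ h)
  · intro u
    have h1 : #(O u) ≤ #{x ∈ G.neighborFinset u | r x < r u} +
        #{v ∈ G.neighborFinset u | 2 * G.degree v ≤ P} :=
      (card_union_le _ _).trans (Nat.add_le_add_left
        ((card_le_card (erase_subset _ _)).trans card_image_le) _)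
    -- A low-degree vertex has at most `P / 2` neighbours, each counted at most twice. For any other
    -- vertex, earlier neighbours have high degree while prescribed witnesses come from low-degree
    -- neighbours, so each neighbour counts at most once.
    by_cases hu : 2 * G.degree u ≤ P
    · have h2 := card_filter_le (G.neighborFinset u) fun x => r x < r u
      have h3 := card_filter_le (G.neighborFinset u) fun v => 2 * G.degree v ≤ P
      rw [card_neighborFinset_eq_degree] at h2 h3
      omega
    · have h2 : #{x ∈ G.neighborFinset u | r x < r u} ≤
          #{v ∈ G.neighborFinset u | ¬ 2 * G.degree v ≤ P} := by
        refine card_le_card fun x hx => ?_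
        rw [mem_filter] at hx ⊢
        exact ⟨hx.1, fun h => hu (hHL u x hx.2 h)⟩
      have h3 := card_filter_add_card_filter_not (s := G.neighborFinset u)
        fun v => 2 * G.degree v ≤ P
      rw [card_neighborFinset_eq_degree] at h3
      have := hP u
      omega
  · intro u x hx
    rcases (hO u x).1 hx with h | ⟨hne, v, ⟨huv, -⟩, rfl⟩
    · exact Or.inl h.1
    · exact Or.inr ⟨v, huv, (hw v ⟨u, huv.symm⟩).1⟩
  · intro u x h
    rcases lt_trichotomy (r x) (r u) with hlt | heq | hlt
    · exact Or.inl ((hO u x).2 (Or.inl ⟨h, hlt⟩))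
    · exact absurd (hr _ _ heq) (G.ne_of_adj h).symm
    · exact Or.inr ((hO x u).2 (Or.inl ⟨h.symm, hlt⟩))
  · intro v hv hne
    exact ⟨w v, (hw v hne).1, fun u hu huw =>
      (hO u _).2 (Or.inr ⟨huw.symm, v, ⟨hu.symm, hv⟩, rfl⟩)⟩

end Structure

/-- Greedy colouring along an acyclic orientation with out-degrees at most `P`. -/
theorem exists_coloring_of_orientation {V : Type*} [Fintype V] (O : V → Finset V) (r : V → ℕ) (P : ℕ)
    (hr : ∀ u, ∀ x ∈ O u, r x < r u) (hO : ∀ u, #(O u) ≤ P) :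
    ∃ τ : V → Fin (P + 1), ∀ u, ∀ x ∈ O u, τ u ≠ τ x := by
  classical
  have h : ∀ (u : V) (τ : V → Fin (P + 1)), ∃ c, ∀ x ∈ O u, c ≠ τ x := by
    intro u τ
    have hlt : #((O u).image τ) < #(univ : Finset (Fin (P + 1))) := by
      rw [Finset.card_univ, Fintype.card_fin]
      exact Nat.lt_succ_of_le (card_image_le.trans (hO u))
    obtain ⟨c, -, hc⟩ := exists_mem_notMem_of_card_lt_card hlt
    exact ⟨c, fun x hx h => hc (mem_image.2 ⟨x, hx, h.symm⟩)⟩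
  have key : ∀ n, ∃ τ : V → Fin (P + 1), ∀ u, r u < n → ∀ x ∈ O u, τ u ≠ τ x := by
    intro n
    induction n with
    | zero => exact ⟨fun _ => 0, fun u hu => absurd hu (Nat.not_lt_zero _)⟩
    | succ n ih =>
      obtain ⟨τ, hτ⟩ := ih
      choose c hc using fun u => h u τ
      refine ⟨fun u => if r u < n then τ u else c u, fun u hu x hx => ?_⟩
      have hxn : r x < n := lt_of_lt_of_le (hr u x hx) (Nat.le_of_lt_succ hu)
      simp only [hxn, if_true]
      split_ifs with hun
      exacts [hτ u hun x hx, hc u x hx]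
  obtain ⟨τ, hτ⟩ := key (univ.sup r + 1)
  exact ⟨τ, fun u => hτ u (Nat.lt_succ_of_le (le_sup (mem_univ u)))⟩

/-- If `P + 1` colours allow for greedy colouring, and `K` further colours provide witnesses to all
vertices whose degree exceeds `P / 2`, then there is a pcf colouring with `P + 1 + K` colours. -/
theorem pcfChromaticNumber_le_of_hasUniqueTaker {V T : Type*} [Fintype V] (G : SimpleGraph V)
    [DecidableRel G.Adj] (P K : ℕ) (z : T) (O : V → Finset V) (r : V → ℕ)
    (hr : ∀ u, ∀ x ∈ O u, r x < r u) (hO : ∀ u, #(O u) ≤ P)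
    (hadj : ∀ u x, G.Adj u x → x ∈ O u ∨ u ∈ O x)
    (hlow : ∀ v, 2 * G.degree v ≤ P → (∃ u, G.Adj v u) →
      ∃ w, G.Adj v w ∧ ∀ u, G.Adj v u → u ≠ w → w ∈ O u)
    (x : V → Fin K → T)
    (hhigh : ∀ v, P < 2 * G.degree v → HasUniqueTaker z O (G.neighborFinset v) x) :
    G.pcfChromaticNumber ≤ K + (P + 1) := by
  classical
  obtain ⟨τ, hτ⟩ := exists_coloring_of_orientation O r P hr hO
  let σ : V → Fin K ⊕ Fin (P + 1) := fun u =>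
    if h : ∃ c, Takes z O x u c then Sum.inl h.choose else Sum.inr (τ u)
  have hσl : ∀ u c, σ u = Sum.inl c ↔ Takes z O x u c := by
    intro u c
    by_cases h : ∃ c, Takes z O x u c
    · simp only [σ, h, dif_pos, Sum.inl.injEq]
      exact ⟨fun hc => hc ▸ h.choose_spec, fun hc => h.choose_spec.unique hc⟩
    · simp only [σ, h, dif_neg, not_false_eq_true, reduceCtorEq, false_iff]
      exact fun hc => h ⟨c, hc⟩
  have hσr : ∀ u c, σ u = Sum.inr c → τ u = c := by
    intro u c hc
    by_cases h : ∃ c, Takes z O x u c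
    · simp [σ, h] at hc
    · simpa [σ, h] using hc
  -- A shared extra colour is impossible: `y` taking `c` means `y` picks `c`, which already blocks
  -- `u`.
  have hσ : ∀ u, ∀ y ∈ O u, σ u ≠ σ y := by
    intro u y hy heq
    rcases hc : σ u with c | c
    · have hu := (hσl u c).1 hc
      have hy' := (hσl y c).1 (heq ▸ hc)
      exact hu.2.2 y hy hy'.1
    · exact hτ u y hy ((hσr u c hc).trans (hσr y c (heq ▸ hc)).symm)
  have hpcf : G.IsPcfColoring σ := by
    refine ⟨fun u v huv => ?_, fun v hv => ?_⟩
    · rcases hadj u v huv with h | h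
      exacts [hσ u v h, (hσ v u h).symm]
    · by_cases hd : 2 * G.degree v ≤ P
      · obtain ⟨w, hvw, hw⟩ := hlow v hd hv
        refine ⟨w, hvw, fun u hu huw => ?_⟩
        by_contra hne
        exact hσ u w (hw u hu hne) huw
      · obtain ⟨c, u, hu, huc, huniq⟩ := hhigh v (not_le.1 hd)
        refine ⟨u, (G.mem_neighborFinset v u).1 hu, fun w hw hwu => ?_⟩
        rw [(hσl u c).2 huc, hσl] at hwu
        exact huniq w ((G.mem_neighborFinset v w).2 hw) hwu
  refine Nat.sInf_le ⟨finSumFinEquiv ∘ σ, fun u v huv h => ?_, fun v hv => ?_⟩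
  · exact hpcf.1 u v huv (finSumFinEquiv.injective h)
  · obtain ⟨u, hu, huniq⟩ := hpcf.2 v hv
    exact ⟨u, hu, fun w hw h => huniq w hw (finSumFinEquiv.injective h)⟩

/-- With `P = 2Δ` every vertex counts as low-degree, so no extra colours are needed. This handles
bounded `Δ`. -/
theorem pcfChromaticNumber_le_two_mul_maxDegree {V : Type*} [Fintype V] (G : SimpleGraph V)
    [DecidableRel G.Adj] : G.pcfChromaticNumber ≤ 2 * G.maxDegree + 1 := by
  have hdeg := G.degree_le_maxDegree
  obtain ⟨O, r, hr, hO, -, hadj, hlow⟩ :=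
    G.exists_constraint_orientation (2 * G.maxDegree) fun u => by have := hdeg u; omega
  have := G.pcfChromaticNumber_le_of_hasUniqueTaker (2 * G.maxDegree) 0 () O r hr hO hadj hlow
    (fun _ => Fin.elim0) fun v hv => by have := hdeg v; omega
  omega

/-! ### Balls, which control the dependencies. -/

/-- The vertices at distance at most `k` from `v`. -/
def closedBall {V : Type*} [Fintype V] [DecidableEq V] (G : SimpleGraph V) [DecidableRel G.Adj]
    (v : V) : ℕ → Finset V
  | 0 => {v}
  | k + 1 => (closedBall G v k).biUnion fun u => insert u (G.neighborFinset u)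

section Ball

variable {V : Type*} [Fintype V] [DecidableEq V] (G : SimpleGraph V) [DecidableRel G.Adj]

theorem mem_closedBall_succ {v x : V} {k : ℕ} :
    x ∈ G.closedBall v (k + 1) ↔ ∃ u ∈ G.closedBall v k, x = u ∨ G.Adj u x := by
  simp [closedBall]

theorem card_closedBall_le (v : V) (k : ℕ) : #(G.closedBall v k) ≤ (G.maxDegree + 1) ^ k := by
  induction k with
  | zero => simp [closedBall]
  | succ k ih =>
    rw [pow_succ]
    refine (card_biUnion_le_card_mul _ _ (G.maxDegree + 1) fun u _ => ?_).trans
      (Nat.mul_le_mul_right _ ih)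
    refine (card_insert_le _ _).trans (Nat.succ_le_succ ?_)
    rw [card_neighborFinset_eq_degree]
    exact G.degree_le_maxDegree u

theorem mem_closedBall_add {v u x : V} {k l : ℕ} (hu : u ∈ G.closedBall v k)
    (hx : x ∈ G.closedBall u l) : x ∈ G.closedBall v (k + l) := by
  induction l generalizing x with
  | zero =>
    rw [closedBall, mem_singleton] at hx
    exact hx ▸ hu
  | succ l ih =>
    obtain ⟨y, hy, h⟩ := (G.mem_closedBall_succ).1 hx
    exact (G.mem_closedBall_succ).2 ⟨y, ih hy, h⟩

theorem mem_closedBall_one {v x : V} : x ∈ G.closedBall v 1 ↔ x = v ∨ G.Adj v x := by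
  simp [closedBall]

theorem mem_closedBall_comm {v x : V} {k : ℕ} (h : x ∈ G.closedBall v k) :
    v ∈ G.closedBall x k := by
  induction k generalizing x with
  | zero =>
    rw [closedBall, mem_singleton] at h ⊢
    exact h.symm
  | succ k ih =>
    obtain ⟨u, hu, h⟩ := (G.mem_closedBall_succ).1 h
    rw [add_comm]
    refine G.mem_closedBall_add ((G.mem_closedBall_one).2 ?_) (ih hu)
    exact h.imp Eq.symm fun h => h.symm

end Ball

-- The two ways to fail each cost `Δ⁻¹⁰`: all rounds fail (`320 = 10 * 32`), or half of the
-- neighbours pick some colour, which is rare since `K ^ 2 ≤ Δ`.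
open Classical in
theorem card_not_hasUniqueTaker_neighborFinset_le {V T : Type*} [Fintype V]
    [Fintype T] (z : T) (G : SimpleGraph V)
    [DecidableRel G.Adj] (K : ℕ) (O : V → Finset V) (r : V → ℕ)
    (hr : ∀ u, ∀ x ∈ O u, r x < r u) (hO : ∀ u, #(O u) ≤ G.maxDegree)
    (hΔ : 80 ≤ G.maxDegree) (hK1 : 320 * Real.log G.maxDegree ≤ K)
    (hK2 : (K : ℝ) ^ 2 ≤ G.maxDegree)
    (hcard : (Fintype.card T : ℝ) = 4 * G.maxDegree) (v : V)
    (hd : G.maxDegree < 2 * G.degree v) :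
    (#{x : V → Fin K → T | ¬ HasUniqueTaker z O (G.neighborFinset v) x} : ℝ) ≤
      2 * (1 / (G.maxDegree : ℝ)) ^ 10 *
        Fintype.card (V → Fin K → T) := by
  set Δ := G.maxDegree with hΔdef
  have hΔ0 : (0 : ℝ) < Δ := by exact_mod_cast (by omega : 0 < Δ)
  have hΔ80 : (80 : ℝ) ≤ Δ := by exact_mod_cast hΔ
  have hdr : (Δ : ℝ) < 2 * G.degree v := by exact_mod_cast hd
  have hdeg : (G.degree v : ℝ) ≤ Δ := by exact_mod_cast G.degree_le_maxDegree v
  have hq0 : (0 : ℝ) ≤ K / (4 * Δ) := by positivity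
  have hy2 : (2 * √((K : ℝ) / (4 * Δ))) ^ 4 ≤ 1 / Δ := by
    have h2 : (√((K : ℝ) / (4 * Δ))) ^ 2 = K / (4 * Δ) := Real.sq_sqrt hq0
    calc (2 * √((K : ℝ) / (4 * Δ))) ^ 4 = 16 * ((√((K : ℝ) / (4 * Δ))) ^ 2) ^ 2 := by ring
      _ = (K : ℝ) ^ 2 / Δ ^ 2 := by rw [h2]; field_simp; ring
      _ ≤ Δ / Δ ^ 2 := by gcongr
      _ = 1 / Δ := by field_simp
  have hyle : 2 * √((K : ℝ) / (4 * Δ)) ≤ 1 := by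
    by_contra hcon
    have h1 := one_lt_pow₀ (not_le.1 hcon) (n := 4) (by norm_num)
    have h2 : 1 / (Δ : ℝ) ≤ 1 := by
      rw [div_le_one hΔ0]; linarith
    linarith
  -- At least `Δ / 4` neighbours without a pick, pick probability `1 / (4Δ)` and a factor `1 - 2Δ /
  -- (4Δ) = 1 / 2` for no interference give `1 / 32`.
  have hmain := card_not_hasUniqueTaker_le z K O (G.neighborFinset v) (2 * Δ) (1 / 32)
    (√((K : ℝ) / (4 * Δ)))
    (fun u _ h => lt_irrefl _ (hr u u h))
    (fun u _ => by
      rw [card_neighborFinset_eq_degree]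
      have : (#(O u) : ℝ) ≤ Δ := by exact_mod_cast hO u
      linarith)
    (by rw [hcard]; linarith) (by norm_num)
    (by
      rw [hcard, card_neighborFinset_eq_degree]
      have h1 : (1 : ℝ) - 2 * Δ / (4 * Δ) = 1 / 2 := by field_simp; norm_num
      rw [h1, div_div, div_mul_eq_mul_div, le_div_iff₀ (by positivity)]
      linarith)
    (Real.sqrt_nonneg _) (by linarith [Real.sqrt_nonneg ((K : ℝ) / (4 * Δ))])
    (by rw [hcard, Real.sq_sqrt hq0])
  refine hmain.trans (mul_le_mul_of_nonneg_right ?_ (by positivity))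
  have h1 : (1 - 1 / 32 : ℝ) ^ K ≤ (1 / Δ) ^ 10 := by
    have h2 : (1 - 1 / 32 : ℝ) ≤ Real.exp (-(1 / 32)) := by
      have := Real.add_one_le_exp (-(1 / 32 : ℝ))
      linarith
    calc (1 - 1 / 32 : ℝ) ^ K ≤ Real.exp (-(1 / 32)) ^ K :=
          pow_le_pow_left₀ (by norm_num) h2 K
      _ = Real.exp (K * -(1 / 32)) := (Real.exp_nat_mul _ _).symm
      _ ≤ Real.exp ((10 : ℕ) * -Real.log Δ) := by
          rw [Real.exp_le_exp]
          push_cast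
          linarith
      _ = (1 / Δ) ^ 10 := by
          rw [Real.exp_nat_mul, Real.exp_neg, Real.exp_log hΔ0, one_div]
  -- The degree exceeds `Δ / 2 ≥ 40`, enough for ten fourth powers, each at most `1 / Δ`.
  have h3 : (2 * √((K : ℝ) / (4 * Δ))) ^ #(G.neighborFinset v) ≤ (1 / Δ) ^ 10 := by
    calc (2 * √((K : ℝ) / (4 * Δ))) ^ #(G.neighborFinset v)
        ≤ (2 * √((K : ℝ) / (4 * Δ))) ^ (4 * 10) :=
          pow_le_pow_of_le_one (by positivity) hyle (by
            rw [card_neighborFinset_eq_degree]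
            omega)
      _ = ((2 * √((K : ℝ) / (4 * Δ))) ^ 4) ^ 10 := pow_mul _ _ _
      _ ≤ _ := pow_le_pow_left₀ (by positivity) hy2 10
  linarith

/-- Witnesses in `K` colours for all vertices of large degree, by the local lemma. -/
theorem exists_forall_hasUniqueTaker {V : Type*} [Fintype V] (G : SimpleGraph V)
    [DecidableRel G.Adj] (K : ℕ) (O : V → Finset V) (r : V → ℕ)
    (hr : ∀ u, ∀ x ∈ O u, r x < r u) (hO : ∀ u, #(O u) ≤ G.maxDegree)
    (hdist : ∀ u, ∀ x ∈ O u, G.Adj u x ∨ ∃ v, G.Adj u v ∧ G.Adj v x)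
    (hΔ : 80 ≤ G.maxDegree) (hK1 : 320 * Real.log G.maxDegree ≤ K)
    (hK2 : (K : ℝ) ^ 2 ≤ G.maxDegree) :
    ∃ (T : Type) (z : T) (x : V → Fin K → T), ∀ v, G.maxDegree < 2 * G.degree v →
      HasUniqueTaker z O (G.neighborFinset v) x := by
  classical
  set Δ := G.maxDegree with hΔdef
  have hΔ0 : (0 : ℝ) < Δ := by exact_mod_cast (by omega : 0 < Δ)
  have hΔ80 : (80 : ℝ) ≤ Δ := by exact_mod_cast hΔ
  have : NeZero (4 * Δ) := ⟨by omega⟩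
  let z : Fin (4 * Δ) := 0
  let B : V → Finset (V → Fin K → Fin (4 * Δ)) := fun v =>
    {x | Δ < 2 * G.degree v ∧ ¬ HasUniqueTaker z O (G.neighborFinset v) x}
  set p : ℝ := 2 * (1 / (Δ : ℝ)) ^ 10 with hp
  have hB : ∀ v, (#(B v) : ℝ) ≤ p * Fintype.card (V → Fin K → Fin (4 * Δ)) := by
    intro v
    by_cases hd : Δ < 2 * G.degree v
    · have hBv : B v = ({x | ¬ HasUniqueTaker z O (G.neighborFinset v) x} : Finset _) := by
        ext x
        simp [B, hd]
      rw [hBv]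
      exact card_not_hasUniqueTaker_neighborFinset_le z G K O r hr hO hΔ hK1 hK2 (by simp [Δ]) v hd
    · have : B v = ∅ := by
        ext x
        simp [B, hd]
      rw [this, card_empty, Nat.cast_zero]
      positivity
  have hball : ∀ v, ∀ u ∈ G.neighborFinset v, u ∈ G.closedBall v 1 := fun v u hu =>
    (G.mem_closedBall_one).2 (Or.inr ((G.mem_neighborFinset v u).1 hu))
  -- A take is blocked by picks, not by takes, so dependence stops at the out-neighbours of
  -- neighbours of `v`.
  have hball3 : ∀ v, ∀ u ∈ G.neighborFinset v, ∀ y, y = u ∨ y ∈ O u → y ∈ G.closedBall v 3 := by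
    intro v u hu y hy
    refine G.mem_closedBall_add (k := 1) (l := 2) (hball v u hu) ?_
    rw [mem_closedBall_succ]
    rcases hy with rfl | hy
    · exact ⟨y, (G.mem_closedBall_one).2 (Or.inl rfl), Or.inl rfl⟩
    rcases hdist u y hy with h | ⟨w, h, h'⟩
    · exact ⟨y, (G.mem_closedBall_one).2 (Or.inr h), Or.inl rfl⟩
    · exact ⟨w, (G.mem_closedBall_one).2 (Or.inr h), Or.inr h'⟩
  obtain ⟨x, hx⟩ := lovasz_local_lemma B (fun v => G.closedBall v 3)
    (by
      intro v x y hxy hx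
      simp only [B, mem_filter, mem_univ, true_and] at hx ⊢
      refine ⟨hx.1, fun ⟨c, u, hu, h, huniq⟩ => hx.2 ⟨c, u, hu, ?_⟩⟩
      have hiff : ∀ w ∈ G.neighborFinset v, (Takes z O x w c ↔ Takes z O y w c) := by
        intro w hw
        have hw' := hxy w (hball3 v w hw w (Or.inl rfl))
        have hO' : ∀ a ∈ O w, x a = y a := fun a ha => hxy a (hball3 v w hw a (Or.inr ha))
        unfold Takes
        rw [hw']
        refine and_congr_right fun _ => and_congr_right fun _ => forall₂_congr fun a ha => ?_
        rw [hO' a ha]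
      exact ⟨(hiff u hu).2 h, fun w hw h' => huniq w hw ((hiff w hw).1 h')⟩)
    (fun v => G.closedBall v 6)
    (fun v w hw => Finset.disjoint_left.2 fun a ha hb =>
      hw (G.mem_closedBall_add (k := 3) (l := 3) ha (G.mem_closedBall_comm hb)))
    p ((Δ + 1 : ℝ) ^ 6) (by positivity) (one_le_pow₀ (by linarith))
    (fun v => by exact_mod_cast G.card_closedBall_le v 6) hB
    (by
      have h1 : (Δ + 1 : ℝ) ^ 6 ≤ (2 * Δ) ^ 6 := by gcongr; linarith
      calc 4 * p * (Δ + 1 : ℝ) ^ 6 ≤ 4 * p * (2 * Δ) ^ 6 :=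
            mul_le_mul_of_nonneg_left h1 (by positivity)
        _ = 512 / Δ ^ 4 := by rw [hp]; field_simp; norm_num
        _ ≤ 1 := by
          rw [div_le_one (by positivity)]
          calc (512 : ℝ) ≤ 80 ^ 4 := by norm_num
            _ ≤ Δ ^ 4 := by gcongr)
  refine ⟨Fin (4 * Δ), z, x, fun v hv => ?_⟩
  by_contra h
  exact hx v (by simp [B, hv, h])

end SimpleGraph

/-! ### Choice of constants. -/

theorem mainTheorem2 :
    ∃ C : ℝ, 0 < C ∧
      ∀ (V : Type*) [Fintype V] (G : SimpleGraph V) [DecidableRel G.Adj],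
        2 ≤ G.maxDegree →
          (G.pcfChromaticNumber : ℝ) ≤ (G.maxDegree : ℝ) + C * Real.log (G.maxDegree : ℝ) := by
  have hlim : ∀ᶠ n : ℕ in Filter.atTop, (320 * Real.log n + 1) ^ 2 ≤ (n : ℝ) := by
    have h1 : (fun t : ℝ => 320 * Real.log t + 1) =o[Filter.atTop] fun t : ℝ => t ^ (1 / 2 : ℝ) :=
      ((isLittleO_log_rpow_atTop (by norm_num)).const_mul_left 320).add
        (Asymptotics.isLittleO_const_left.2 (Or.inr
          (tendsto_norm_atTop_atTop.comp (tendsto_rpow_atTop (by norm_num)))))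
    have h2 := (h1.bound one_pos).and (Filter.eventually_ge_atTop 0)
    refine (tendsto_natCast_atTop_atTop (R := ℝ)).eventually
      (p := fun t : ℝ => (320 * Real.log t + 1) ^ 2 ≤ t) (h2.mono fun t ht => ?_)
    obtain ⟨ht, ht0⟩ := ht
    rw [one_mul, ← Real.sqrt_eq_rpow] at ht
    calc (320 * Real.log t + 1) ^ 2 = ‖320 * Real.log t + 1‖ ^ 2 := by
          rw [Real.norm_eq_abs, sq_abs]
      _ ≤ ‖√t‖ ^ 2 := pow_le_pow_left₀ (norm_nonneg _) ht 2
      _ = t := by rw [Real.norm_eq_abs, sq_abs, Real.sq_sqrt ht0]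
  obtain ⟨n₀, hn₀⟩ := Filter.eventually_atTop.1 hlim
  have hlog2 : 0 < Real.log 2 := Real.log_pos (by norm_num)
  -- As `log Δ ≥ log 2`, the second summand contributes at least `n₀ + 81`. This absorbs the
  -- rounding of `K` and the extra greedy colour for large `Δ`, and the bound `2Δ + 1` when `Δ < n₀
  -- + 80`.
  refine ⟨320 + (n₀ + 81) / Real.log 2, by positivity, ?_⟩
  intro V _ G _ hΔ
  set Δ := G.maxDegree with hΔdef
  have hlog : Real.log 2 ≤ Real.log Δ :=
    Real.log_le_log (by norm_num) (by exact_mod_cast hΔ)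
  have hC : (n₀ + 81 : ℝ) ≤ (n₀ + 81) / Real.log 2 * Real.log Δ := by
    rw [div_mul_eq_mul_div, le_div_iff₀ hlog2]
    gcongr
  rw [add_mul]
  by_cases hlarge : n₀ + 80 ≤ Δ
  · set K := ⌈320 * Real.log Δ⌉₊ with hK
    have hK1 : 320 * Real.log Δ ≤ K := Nat.le_ceil _
    have hK2 : (K : ℝ) < 320 * Real.log Δ + 1 := Nat.ceil_lt_add_one (by linarith)
    obtain ⟨O, r, hr, hO, hdist, hadj, hlow⟩ :=
      G.exists_constraint_orientation Δ G.degree_le_maxDegree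
    obtain ⟨T, z, x, hx⟩ := G.exists_forall_hasUniqueTaker K O r hr hO hdist (by omega) hK1
      ((pow_le_pow_left₀ (Nat.cast_nonneg _) hK2.le 2).trans (hn₀ Δ (by omega)))
    have h := G.pcfChromaticNumber_le_of_hasUniqueTaker Δ K z O r hr hO hadj hlow x hx
    have h' : (G.pcfChromaticNumber : ℝ) ≤ K + (Δ + 1) := by exact_mod_cast h
    have : (0 : ℝ) ≤ n₀ := Nat.cast_nonneg _
    linarith
  · have h := G.pcfChromaticNumber_le_two_mul_maxDegree
    have h' : (G.pcfChromaticNumber : ℝ) ≤ 2 * Δ + 1 := by exact_mod_cast h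
    have h2 : (Δ : ℝ) ≤ n₀ + 80 := by exact_mod_cast (not_le.1 hlarge).le
    linarith
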